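/- Let $\mathcal H$ be a separable complex Hilbert space of infinite dimension, $Z$ an uncountable standard Borel space, and for each $[\psi]\in\mathbb P(\mathcal H)$ let $\mu_{[\psi]}$ be a probability measure without atoms on $Z$. Let $\lambda$ be the Lebesgue measure on $]0,1[$. A barrier associated to $[\psi]$ is a Borel function $\alpha:Z\to\,]0,1[$ with $\alpha_*\mu_{[\psi]}=\lambda$; a complete state is a triple $([\psi],\alpha,z)$ with $[\psi]\in\mathbb P(\mathcal H)$, $\alpha$ a barrier associated to $[\psi]$ and $z\in Z$. Let $\mathcal C$ be the set of complete states. For a (possibly unbounded) self-adjoint operator $A$ with spectral family $(E^A_{(-\infty,r]})_{r\in\mathbb R}$, the values function $\widehat A:\mathcal C\to\mathbb R$ is $$\widehat A([\psi],\alpha,z)=\min\{r\in\mathbb R:\ \langle\psi,E^A_{(-\infty,r]}\psi\rangle\ge\alpha(z)\}\qquad(\|\psi\|=1).$$ A complex of equivalences is a family $\sigma=(\sigma_{[\psi]})_{[\psi]\in\mathbb P(\mathcal H)}$ of Borel equivalences $\sigma_{[\psi]}:Z\setminus M_{[\psi]}\to\,]0,1[\,\setminus N_{[\psi]}$, where $M_{[\psi]}$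 and $N_{[\psi]}$ are Borel sets with $\mu_{[\psi]}(M_{[\psi]})=0$ and $\lambda(N_{[\psi]})=0$, such that $(\sigma_{[\psi]})_*\mu_{[\psi]}=\lambda$. Given $\sigma$ and a unitary operator $U$ on $\mathcal H$, let $\mathcal C_{U,\sigma}\subseteq\mathcal C$ be the set of the complete states $([\psi],\alpha,z)$ such that $\sigma_{[U\psi]}^{-1}\circ\sigma_{[\psi]}$ is defined at $z$, and define $\widehat U_\sigma:\mathcal C_{U,\sigma}\to\mathcal C$ by $$\widehat U_\sigma([\psi],\alpha,z)=\bigl([U\psi],\ \alpha\circ\sigma_{[\psi]}^{-1}\circ\sigma_{[U\psi]},\ (\sigma_{[U\psi]}^{-1}\circ\sigma_{[\psi]})(z)\bigr),$$ where on the $\mu_{[U\psi]}$-null set on which $\sigma_{[\psi]}^{-1}\circ\sigma_{[U\psi]}$ is not defined the second component is given the values of $\alpha$. Theorem. For every self-adjoint operator $A$ on $\mathcal H$, every complex of equivalences $\sigma$ and every unitary operator $U$ on $\mathcal H$, $$\widehat{U^{-1}AU}=\widehat A\circ\widehat U_\sigma\quad\text{on }\mathcal C_{U,\sigma}.$$ Moreover,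 for every $[\psi]$ and every barrier $\alpha$ associated to $[\psi]$, $([\psi],\alpha,z)\in\mathcal C_{U,\sigma}$ for $\mu_{[\psi]}$-almost every $z$; and if all the $\sigma_{[\psi]}$ are defined everywhere, that is $M_{[\psi]}=\varnothing$ and $N_{[\psi]}=\varnothing$ for every $[\psi]$, then $\mathcal C_{U,\sigma}=\mathcal C$, so that the identity holds on all of $\mathcal C$. -/

import Mathlib

open Set Filter Topology MeasureTheory
open scoped LinearAlgebra.Projectivization ENNReal InnerProductSpace

noncomputable section

namespace CompleteQM

/-! ### Self-adjoint operators and their spectral families -/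

section Operators

variable {H : Type*} [NormedAddCommGroup H] [InnerProductSpace ℂ H]

/-- A (right-continuous) spectral family on `H`: orthogonal projections `E r`, increasing and
strongly right-continuous in `r`, tending strongly to `0` at `-∞` and to the identity at `+∞`. -/
structure SpectralFamily (H : Type*) [NormedAddCommGroup H] [InnerProductSpace ℂ H]
    [CompleteSpace H] where
  /-- the projection `E (-∞, r]` -/
  proj : ℝ → H →L[ℂ] H
  isStarProjection : ∀ r, IsStarProjection (proj r)
  mul_of_le : ∀ r s, r ≤ s → proj s * proj r = proj r
  right_continuous : ∀ (x : H) (r : ℝ), ContinuousWithinAt (fun s => proj s x) (Ici r) r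
  tendsto_atBot : ∀ x : H, Tendsto (fun r => proj r x) atBot (𝓝 0)
  tendsto_atTop : ∀ x : H, Tendsto (fun r => proj r x) atTop (𝓝 x)

variable [CompleteSpace H]

lemma norm_proj_le (P : H →L[ℂ] H) (hP : IsStarProjection P) (x : H) : ‖P x‖ ≤ ‖x‖ :=
  (P.le_of_opNorm_le hP.norm_le x).trans (by simp)

/-- The distribution function `r ↦ ‖E r x‖ ^ 2 = ⟪x, E r x⟫`. -/
def SpectralFamily.distribution (E : SpectralFamily H) (x : H) : StieltjesFunction ℝ where
  toFun r := ‖E.proj r x‖ ^ 2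
  mono' := by
    intro r s hrs
    have h1 : E.proj r = E.proj r * E.proj s := by
      have := congrArg star (E.mul_of_le r s hrs)
      rw [star_mul, (E.isStarProjection r).isSelfAdjoint.star_eq,
        (E.isStarProjection s).isSelfAdjoint.star_eq] at this
      exact this.symm
    have h2 : E.proj r x = E.proj r (E.proj s x) := by
      conv_lhs => rw [h1]
      rfl
    have h3 : ‖E.proj r x‖ ≤ ‖E.proj s x‖ := by
      rw [h2]; exact norm_proj_le _ (E.isStarProjection r) _
    exact pow_le_pow_left₀ (norm_nonneg _) h3 2
  right_continuous' r := ((E.right_continuous x r).norm).pow 2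

/-- `E` is the spectral family of the (possibly unbounded) operator `A`, that is
`A = ∫ t dE(t)`: the domain of `A` consists of the vectors `x` with
`∫ t ^ 2 d⟪x, E(t) x⟫ < ∞`, and `⟪x, A x⟫ = ∫ t d⟪x, E(t) x⟫` for each such `x`. -/
structure SpectralFamily.IsSpectralFamilyOf (E : SpectralFamily H) (A : H →ₗ.[ℂ] H) : Prop where
  mem_domain_iff : ∀ x : H,
    x ∈ A.domain ↔ ∫⁻ t, ENNReal.ofReal (t ^ 2) ∂(E.distribution x).measure < ∞
  inner_apply : ∀ x : A.domain,
    ⟪(x : H), A x⟫_ℂ = ((∫ t, t ∂(E.distribution (x : H)).measure : ℝ) : ℂ)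

/-- The self-adjoint (densely defined, possibly unbounded) operators on `H`. -/
def SelfAdjointOperator (H : Type*) [NormedAddCommGroup H] [InnerProductSpace ℂ H]
    [CompleteSpace H] : Type _ :=
  {A : H →ₗ.[ℂ] H // IsSelfAdjoint A}

open Classical in
/-- The spectral projection `E^A_(-∞, r]`, taken from the spectral family of `A`, which exists
and is unique by the spectral theorem. -/
def SelfAdjointOperator.spectralProj (A : SelfAdjointOperator H) (r : ℝ) : H →L[ℂ] H :=
  if h : ∃ E : SpectralFamily H, E.IsSpectralFamilyOf A.1 then h.choose.proj r else 0

/-- The operator `U⁻¹ A U`, with domain `{x | U x ∈ D(A)}`. -/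
def conjPMap (A : H →ₗ.[ℂ] H) (U : H ≃ₗᵢ[ℂ] H) : H →ₗ.[ℂ] H where
  domain := A.domain.comap (U.toLinearEquiv : H →ₗ[ℂ] H)
  toFun :=
    { toFun := fun x => U.symm (A ⟨U x, x.2⟩)
      map_add' := fun x y => by
        rw [← map_add, ← LinearPMap.map_add]
        congr 2
        exact Subtype.ext (map_add U _ _)
      map_smul' := fun c x => by
        rw [RingHom.id_apply, ← map_smul, ← LinearPMap.map_smul]
        congr 2
        exact Subtype.ext (map_smul U _ _) }

lemma conjPMap_isSelfAdjoint {A : H →ₗ.[ℂ] H} (hA : IsSelfAdjoint A) (U : H ≃ₗᵢ[ℂ] H) :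
    IsSelfAdjoint (conjPMap A U) := by
  have hdense : Dense ((conjPMap A U).domain : Set H) :=
    hA.dense_domain.preimage U.toHomeomorph.isOpenMap
  have hA' : A.adjoint = A := hA
  have hsymm : A.IsFormalAdjoint A := by
    have := LinearPMap.adjoint_isFormalAdjoint hA.dense_domain
    rwa [hA'] at this
  have hformal : (conjPMap A U).IsFormalAdjoint (conjPMap A U) := by
    intro x y
    have h := hsymm ⟨U x, x.2⟩ ⟨U y, y.2⟩
    change ⟪U.symm (A ⟨U x, x.2⟩), (y : H)⟫_ℂ = ⟪(x : H), U.symm (A ⟨U y, y.2⟩)⟫_ℂ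
    rw [← U.inner_map_map, U.apply_symm_apply, h, ← U.inner_map_map (x : H), U.apply_symm_apply]
  refine (LinearPMap.eq_of_le_of_domain_eq (hformal.le_adjoint hdense) ?_).symm
  refine le_antisymm (hformal.le_adjoint hdense).1 fun y hy => ?_
  have hw : ∀ x : A.domain, ⟪U ((conjPMap A U).adjoint ⟨y, hy⟩), (x : H)⟫_ℂ = ⟪U y, A x⟫_ℂ := by
    intro x
    have hx : U.symm x ∈ (conjPMap A U).domain := by
      change U (U.symm x) ∈ A.domain
      rw [U.apply_symm_apply]; exact x.2
    have h := LinearPMap.adjoint_isFormalAdjoint hdense ⟨y, hy⟩ ⟨U.symm x, hx⟩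
    change ⟪_, U.symm (x : H)⟫_ℂ = ⟪y, U.symm (A ⟨U (U.symm x), hx⟩)⟫_ℂ at h
    have e : A ⟨U (U.symm x), hx⟩ = A x := congrArg A (Subtype.ext (U.apply_symm_apply _))
    rw [e, ← U.inner_map_map, U.apply_symm_apply, ← U.inner_map_map y, U.apply_symm_apply] at h
    exact h
  have := LinearPMap.mem_adjoint_domain_of_exists (T := A) (U y) ⟨_, hw⟩
  rw [hA'] at this
  exact this

/-- `U⁻¹ A U` as a self-adjoint operator. -/
def SelfAdjointOperator.conj (A : SelfAdjointOperator H) (U : H ≃ₗᵢ[ℂ] H) :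
    SelfAdjointOperator H :=
  ⟨conjPMap A.1 U, conjPMap_isSelfAdjoint A.2 U⟩

/-- The expectation `⟨T⟩_ψ` in the pure state `[ψ]`: it is `⟪ψ, T ψ⟫` for a unit
representative, that is `⟪ψ, T ψ⟫ / ‖ψ‖ ^ 2` for an arbitrary one. -/
def expectation (T : H →L[ℂ] H) (p : ℙ ℂ H) : ℝ :=
  Projectivization.lift (fun v : {v : H // v ≠ 0} => (⟪(v : H), T v⟫_ℂ).re / ‖(v : H)‖ ^ 2)
    (by
      rintro ⟨a, ha⟩ ⟨b, hb⟩ t h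
      dsimp only at h ⊢
      subst h
      have ht : t ≠ 0 := fun h0 => ha (by rw [h0, zero_smul])
      have ht' : ‖t‖ ^ 2 ≠ 0 := pow_ne_zero 2 (norm_ne_zero_iff.mpr ht)
      have h1 : ⟪t • b, T (t • b)⟫_ℂ = ((‖t‖ ^ 2 : ℝ) : ℂ) * ⟪b, T b⟫_ℂ := by
        rw [map_smul, inner_smul_left, inner_smul_right, ← mul_assoc, Complex.conj_mul']
        push_cast
        rfl
      rw [h1, Complex.re_ofReal_mul, norm_smul, mul_pow, mul_div_mul_left _ _ ht']) p

/-- `F^A_ψ(r) = ⟨E^A_(-∞, r]⟩_ψ`. -/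
def distributionFunction (A : SelfAdjointOperator H) (p : ℙ ℂ H) (r : ℝ) : ℝ :=
  expectation (A.spectralProj r) p

/-- The projective transformation `[ψ] ↦ [U ψ]`. -/
def projAction (U : H ≃ₗᵢ[ℂ] H) (p : ℙ ℂ H) : ℙ ℂ H :=
  Projectivization.map (U.toLinearEquiv : H →ₗ[ℂ] H) U.injective p

end Operators

/-- The quasi-inverse (quantile function) `F⁽⁻¹⁾(s) = min {r | s ≤ F r}`. -/
def quasiInverse (F : ℝ → ℝ) (s : ℝ) : ℝ := sInf {r : ℝ | s ≤ F r}

/-- For a distribution function and `0 < s < 1` the minimum in `quasiInverse` is attained. -/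
lemma quasiInverse_isLeast {F : ℝ → ℝ} (hmono : Monotone F)
    (hcont : ∀ r, ContinuousWithinAt F (Ici r) r) (hbot : Tendsto F atBot (𝓝 0))
    (htop : Tendsto F atTop (𝓝 1)) {s : ℝ} (hs0 : 0 < s) (hs1 : s < 1) :
    IsLeast {r : ℝ | s ≤ F r} (quasiInverse F s) := by
  have hne : {r : ℝ | s ≤ F r}.Nonempty := by
    obtain ⟨r, hr⟩ := (htop.eventually (lt_mem_nhds hs1)).exists
    exact ⟨r, hr.le⟩
  have hbdd : BddBelow {r : ℝ | s ≤ F r} := by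
    obtain ⟨a, ha⟩ := (hbot.eventually (gt_mem_nhds hs0)).exists
    refine ⟨a, fun r hr => ?_⟩
    by_contra hlt
    exact absurd ((show s ≤ F r from hr).trans (hmono (not_le.mp hlt).le)) (not_le.mpr ha)
  refine ⟨?_, fun r hr => csInf_le hbdd hr⟩
  have hgt : ∀ r, quasiInverse F s < r → s ≤ F r := by
    intro r hr
    obtain ⟨r', hr', hlt⟩ := exists_lt_of_csInf_lt hne hr
    exact (show s ≤ F r' from hr').trans (hmono hlt.le)
  have h1 : Tendsto F (𝓝[>] (quasiInverse F s)) (𝓝 (F (quasiInverse F s))) :=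
    (hcont _).mono_left (nhdsWithin_mono _ Ioi_subset_Ici_self)
  exact ge_of_tendsto h1 (eventually_nhdsWithin_of_forall hgt)

/-! ### Barriers, complete states, values functions -/

section States

variable {H : Type*} [NormedAddCommGroup H] [InnerProductSpace ℂ H] [CompleteSpace H]
variable {Z : Type*} [MeasurableSpace Z]

/-- The Lebesgue measure of the interval `]0,1[`. -/
def lebesgueIoo : Measure (Ioo (0 : ℝ) 1) := (volume : Measure ℝ).comap Subtype.val

/-- A probability barrier for the measure `ν` on `Z`: a Borel function `α : Z → ]0,1[` with
`α_* ν` the Lebesgue measure of `]0,1[`. -/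
structure Barrier (ν : Measure Z) where
  toFun : Z → Ioo (0 : ℝ) 1
  measurable : Measurable toFun
  map_eq : ν.map toFun = lebesgueIoo

/-- A complete state `([ψ], α, z)`: a pure state, a barrier associated to it and a label. -/
structure CompleteState (μ : ℙ ℂ H → Measure Z) where
  state : ℙ ℂ H
  barrier : Barrier (μ state)
  label : Z

/-- The values function `Â : ([ψ], α, z) ↦ min {r | F^A_ψ(r) ≥ α z}`. -/
def valuesFunction {μ : ℙ ℂ H → Measure Z} (A : SelfAdjointOperator H)
    (c : CompleteState μ) : ℝ :=
  quasiInverse (distributionFunction A c.state) (c.barrier.toFun c.label : ℝ)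

/-! ### Equivalences defined out of null sets -/

/-- A Borel equivalence `σ : Z → ]0,1[`, defined out of null Borel subsets of `Z` and of `]0,1[`,
with `σ_* ν` the Lebesgue measure of `]0,1[`. -/
structure BorelEquivalence (ν : Measure Z) where
  source : Set Z
  measurableSet_source : MeasurableSet source
  source_compl_null : ν sourceᶜ = 0
  target : Set (Ioo (0 : ℝ) 1)
  measurableSet_target : MeasurableSet target
  target_compl_null : lebesgueIoo targetᶜ = 0
  equiv : source ≃ᵐ target
  map_eq : (ν.comap (Subtype.val : source → Z)).map
    (fun z => ((equiv z : target) : Ioo (0 : ℝ) 1)) = lebesgueIoo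

/-- A complex of equivalences: one for each pure state. -/
def ComplexOfEquivalences (μ : ℙ ℂ H → Measure Z) : Type _ :=
  ∀ p : ℙ ℂ H, BorelEquivalence (μ p)

namespace BorelEquivalence

variable {ν ν' : Measure Z}

lemma measurableSet_preimage (σ : BorelEquivalence ν) {S : Set (Ioo (0 : ℝ) 1)}
    (hS : MeasurableSet S) :
    MeasurableSet {z : Z | ∃ h : z ∈ σ.source, ((σ.equiv ⟨z, h⟩ : σ.target) : Ioo (0 : ℝ) 1) ∈ S} := by
  have h1 : MeasurableSet {z : σ.source | ((σ.equiv z : σ.target) : Ioo (0 : ℝ) 1) ∈ S} :=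
    (measurable_subtype_coe.comp σ.equiv.measurable) hS
  convert MeasurableSet.subtype_image σ.measurableSet_source h1 using 1
  ext z
  simp

lemma measure_preimage (σ : BorelEquivalence ν) {S : Set (Ioo (0 : ℝ) 1)} (hS : MeasurableSet S) :
    ν {z : Z | ∃ h : z ∈ σ.source, ((σ.equiv ⟨z, h⟩ : σ.target) : Ioo (0 : ℝ) 1) ∈ S}
      = lebesgueIoo S := by
  have hm : Measurable fun z : σ.source => ((σ.equiv z : σ.target) : Ioo (0 : ℝ) 1) :=
    measurable_subtype_coe.comp σ.equiv.measurable
  rw [← σ.map_eq, Measure.map_apply hm hS,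
    (MeasurableEmbedding.subtype_coe σ.measurableSet_source).comap_apply]
  congr 1
  ext z
  simp

lemma measurableSet_symm_preimage (σ : BorelEquivalence ν) {T : Set Z} (hT : MeasurableSet T) :
    MeasurableSet {t : Ioo (0 : ℝ) 1 | ∃ h : t ∈ σ.target,
      ((σ.equiv.symm ⟨t, h⟩ : σ.source) : Z) ∈ T} := by
  have h1 : MeasurableSet {t : σ.target | ((σ.equiv.symm t : σ.source) : Z) ∈ T} :=
    (measurable_subtype_coe.comp σ.equiv.symm.measurable) hT
  convert MeasurableSet.subtype_image σ.measurableSet_target h1 using 1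
  ext t
  simp

lemma volume_symm_preimage (σ : BorelEquivalence ν) {T : Set Z} (hT : MeasurableSet T) :
    lebesgueIoo {t : Ioo (0 : ℝ) 1 | ∃ h : t ∈ σ.target, ((σ.equiv.symm ⟨t, h⟩ : σ.source) : Z) ∈ T}
      = ν T := by
  rw [← σ.measure_preimage (σ.measurableSet_symm_preimage hT)]
  have h2 : ν T = ν (T ∩ σ.source) := (measure_inter_conull σ.source_compl_null).symm
  rw [h2]
  congr 1
  ext z
  simp only [mem_ofPred_eq, mem_inter_iff]
  constructor
  · rintro ⟨hz, ht, hT⟩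
    simp only [Subtype.coe_eta, MeasurableEquiv.symm_apply_apply] at hT
    exact ⟨hT, hz⟩
  · rintro ⟨hT, hz⟩
    exact ⟨hz, Subtype.coe_prop _, by simpa using hT⟩

/-- The set of points `z` at which `(σ')⁻¹ ∘ σ` is defined. -/
def transDomain (σ : BorelEquivalence ν) (σ' : BorelEquivalence ν') : Set Z :=
  {z : Z | ∃ h : z ∈ σ.source, ((σ.equiv ⟨z, h⟩ : σ.target) : Ioo (0 : ℝ) 1) ∈ σ'.target}

/-- The map `(σ')⁻¹ ∘ σ` on its domain. -/
def trans (σ : BorelEquivalence ν) (σ' : BorelEquivalence ν') (z : transDomain σ σ') : Z :=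
  (σ'.equiv.symm ⟨((σ.equiv ⟨z.1, z.2.1⟩ : σ.target) : Ioo (0 : ℝ) 1), z.2.2⟩ : σ'.source)

lemma measurableSet_transDomain (σ : BorelEquivalence ν) (σ' : BorelEquivalence ν') :
    MeasurableSet (transDomain σ σ') :=
  σ.measurableSet_preimage σ'.measurableSet_target

lemma transDomain_compl_null (σ : BorelEquivalence ν) (σ' : BorelEquivalence ν') :
    ν (transDomain σ σ')ᶜ = 0 := by
  have hsub : (transDomain σ σ')ᶜ ⊆ σ.sourceᶜ ∪
      {z : Z | ∃ h : z ∈ σ.source, ((σ.equiv ⟨z, h⟩ : σ.target) : Ioo (0 : ℝ) 1) ∈ σ'.targetᶜ} := by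
    intro z hz
    by_cases h : z ∈ σ.source
    · exact Or.inr ⟨h, fun h' => hz ⟨h, h'⟩⟩
    · exact Or.inl h
  refine measure_mono_null hsub (measure_union_null σ.source_compl_null ?_)
  rw [σ.measure_preimage σ'.measurableSet_target.compl]
  exact σ'.target_compl_null

lemma measurable_trans (σ : BorelEquivalence ν) (σ' : BorelEquivalence ν') :
    Measurable (BorelEquivalence.trans σ σ') := by
  refine measurable_subtype_coe.comp (σ'.equiv.symm.measurable.comp ?_)
  refine Measurable.subtype_mk (measurable_subtype_coe.comp (σ.equiv.measurable.comp ?_))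
  exact measurable_subtype_coe.subtype_mk

end BorelEquivalence

open Classical in
/-- The barrier `α ∘ σ⁻¹ ∘ σ'`. On the null set where the composition is not defined the values
of `α` are kept, so that the result is again defined on the whole of `Z`. -/
def Barrier.transport {ν ν' : Measure Z} (α : Barrier ν) (σ : BorelEquivalence ν)
    (σ' : BorelEquivalence ν') : Barrier ν' where
  toFun w := if h : w ∈ BorelEquivalence.transDomain σ' σ
    then α.toFun (BorelEquivalence.trans σ' σ ⟨w, h⟩) else α.toFun w
  measurable := Measurable.dite
    (f := fun w => α.toFun (BorelEquivalence.trans σ' σ w)) (g := fun w => α.toFun w.1)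
    (α.measurable.comp (BorelEquivalence.measurable_trans σ' σ))
    (α.measurable.comp measurable_subtype_coe) (BorelEquivalence.measurableSet_transDomain σ' σ)
  map_eq := by
    have hmeas := Measurable.dite
      (f := fun w => α.toFun (BorelEquivalence.trans σ' σ w)) (g := fun w => α.toFun w.1)
      (α.measurable.comp (BorelEquivalence.measurable_trans σ' σ))
      (α.measurable.comp measurable_subtype_coe) (BorelEquivalence.measurableSet_transDomain σ' σ)
    ext B hB
    rw [Measure.map_apply hmeas hB]
    have hT : MeasurableSet (α.toFun ⁻¹' B) := α.measurable hB
    have key := σ'.measure_preimage (σ.measurableSet_symm_preimage hT)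
    rw [σ.volume_symm_preimage hT, ← Measure.map_apply α.measurable hB, α.map_eq] at key
    rw [← key, ← measure_inter_conull (BorelEquivalence.transDomain_compl_null σ' σ)]
    congr 1
    ext w
    simp only [mem_inter_iff, mem_preimage, mem_ofPred_eq]
    constructor
    · rintro ⟨h1, h2⟩
      rw [dif_pos h2] at h1
      exact ⟨h2.1, h2.2, h1⟩
    · rintro ⟨h1, h2, h3⟩
      have hw : w ∈ BorelEquivalence.transDomain σ' σ := ⟨h1, h2⟩
      refine ⟨?_, hw⟩
      rw [dif_pos hw]
      exact h3

/-! ### The automorphism of complete states -/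

/-- The complete states `([ψ], α, z)` at which `σ_[Uψ]⁻¹ ∘ σ_[ψ]` is defined at `z`. -/
def automorphismDomain {μ : ℙ ℂ H → Measure Z} (U : H ≃ₗᵢ[ℂ] H) (σ : ComplexOfEquivalences μ) :
    Set (CompleteState μ) :=
  {c | c.label ∈ BorelEquivalence.transDomain (σ c.state) (σ (projAction U c.state))}

/-- `Û_σ([ψ], α, z) = ([Uψ], α ∘ σ_[ψ]⁻¹ ∘ σ_[Uψ], (σ_[Uψ]⁻¹ ∘ σ_[ψ]) z)`. -/
def automorphism {μ : ℙ ℂ H → Measure Z} (U : H ≃ₗᵢ[ℂ] H) (σ : ComplexOfEquivalences μ)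
    (c : automorphismDomain U σ) : CompleteState μ where
  state := projAction U c.1.state
  barrier := c.1.barrier.transport (σ c.1.state) (σ (projAction U c.1.state))
  label := BorelEquivalence.trans (σ c.1.state) (σ (projAction U c.1.state)) ⟨c.1.label, c.2⟩

end States

end CompleteQM

end

namespace CompleteQM

/-! Both sides of the identity are quantiles of a distribution function at a level. The levels agree
because σ_[ψ]⁻¹ ∘ σ_[Uψ] undoes σ_[Uψ]⁻¹ ∘ σ_[ψ], so the transported barrier at the transported
label is α z (`Barrier.transport_trans`). The distribution functions agree because the spectral
projections of U⁻¹AU are U⁻¹E(r)U (`spectralProj_conj`). The domain claims are set-theoretic: the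
excluded labels lie in M_[ψ] or in the σ_[ψ]-preimage of N_[Uψ], both null.

Since `spectralProj` reads off a chosen spectral family, the real work is uniqueness (`unique`),
starting only from the quadratic form ∫ t d⟪x, E(t)x⟫. Spectral measures add along x = E(s)x + (x -
E(s)x), so the form splits; symmetry of A and density of its domain turn this into commutation of A
with E(s). Let E, E' be spectral families of A, let b < c ≤ d, and let k be the midpoint of [c, d].
Then A - k has norm at most (d - c)/2 on the range of E'(d) - E'(c), and expands by at least k - b
on the range of E(b) within the domain. As k - b > (d - c)/2, the product E(b)(E'(d) - E'(c)) must
vanish. The limits d → ∞ and c ↓ b give E(b)E'(b) = E(b); exchanging the families and taking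
adjoints gives E = E'. -/

lemma eq_zero_of_forall_re_inner_eq_zero {H : Type*} [NormedAddCommGroup H]
    [InnerProductSpace ℂ H] {D : Set H} (hD : Dense D) {w : H}
    (h : ∀ u ∈ D, (⟪u, w⟫_ℂ).re = 0) : w = 0 := by
  have hc : Continuous fun u : H => (⟪u, w⟫_ℂ).re := by fun_prop
  have h0 : (fun u : H => (⟪u, w⟫_ℂ).re) = fun _ => 0 :=
    hc.ext_on hD continuous_const h
  have h1 : (⟪w, w⟫_ℂ).re = 0 := congrFun h0 w
  have h2 : (⟪w, w⟫_ℂ).re = ‖w‖ ^ 2 := inner_self_eq_norm_sq (𝕜 := ℂ) w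
  rw [h2] at h1
  exact norm_eq_zero.1 (pow_eq_zero_iff two_ne_zero |>.1 h1)

/-! ### Uniqueness of the spectral family of a self-adjoint operator -/

section SpectralUniqueness

variable {H : Type*} [NormedAddCommGroup H] [InnerProductSpace ℂ H] [CompleteSpace H]

/-! ### Orthogonal projections -/

lemma inner_starProjection_left {P : H →L[ℂ] H} (hP : IsStarProjection P) (x y : H) :
    ⟪P x, y⟫_ℂ = ⟪x, P y⟫_ℂ :=
  hP.isSelfAdjoint.isSymmetric x y

lemma starProjection_apply_apply {P : H →L[ℂ] H} (hP : IsStarProjection P) (x : H) :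
    P (P x) = P x :=
  congrArg (fun T : H →L[ℂ] H => T x) hP.isIdempotentElem.eq

/-! ### Algebra of a spectral family -/

namespace SpectralFamily

variable (E : SpectralFamily H)

@[ext] lemma ext {E E' : SpectralFamily H} (h : ∀ r, E.proj r = E'.proj r) : E = E' := by
  cases E; cases E'
  congr
  exact funext h

lemma proj_proj_of_le {r s : ℝ} (h : r ≤ s) (x : H) : E.proj s (E.proj r x) = E.proj r x :=
  congrArg (fun T : H →L[ℂ] H => T x) (E.mul_of_le r s h)

/-- The adjoint of `proj_proj_of_le`. -/
lemma proj_proj_of_ge {r s : ℝ} (h : r ≤ s) (x : H) : E.proj r (E.proj s x) = E.proj r x := by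
  refine ext_inner_left ℂ fun y => ?_
  rw [← inner_starProjection_left (E.isStarProjection r),
    ← inner_starProjection_left (E.isStarProjection s), E.proj_proj_of_le h,
    inner_starProjection_left (E.isStarProjection r)]

lemma proj_comm (r s : ℝ) (x : H) : E.proj r (E.proj s x) = E.proj s (E.proj r x) := by
  rcases le_total r s with h | h
  · rw [E.proj_proj_of_le h, E.proj_proj_of_ge h]
  · rw [E.proj_proj_of_le h, E.proj_proj_of_ge h]

/-! ### The distribution of a vector -/

lemma distribution_apply (x : H) (r : ℝ) : E.distribution x r = ‖E.proj r x‖ ^ 2 := rfl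

lemma tendsto_distribution_atBot (x : H) : Tendsto (E.distribution x) atBot (𝓝 0) := by
  have := ((E.tendsto_atBot x).norm).pow 2
  rwa [norm_zero, zero_pow two_ne_zero] at this

lemma tendsto_distribution_atTop (x : H) : Tendsto (E.distribution x) atTop (𝓝 (‖x‖ ^ 2)) :=
  ((E.tendsto_atTop x).norm).pow 2

instance (x : H) : IsFiniteMeasure (E.distribution x).measure :=
  (E.distribution x).isFiniteMeasure (E.tendsto_distribution_atBot x)
    (E.tendsto_distribution_atTop x)

lemma measure_distribution_univ (x : H) :
    (E.distribution x).measure univ = ENNReal.ofReal (‖x‖ ^ 2) := by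
  rw [(E.distribution x).measure_univ (E.tendsto_distribution_atBot x)
    (E.tendsto_distribution_atTop x), sub_zero]

lemma measureReal_distribution_univ (x : H) :
    (E.distribution x).measure.real univ = ‖x‖ ^ 2 := by
  rw [measureReal_def, measure_distribution_univ, ENNReal.toReal_ofReal (by positivity)]

lemma norm_sq_eq_add (s : ℝ) (x : H) :
    ‖x‖ ^ 2 = ‖E.proj s x‖ ^ 2 + ‖x - E.proj s x‖ ^ 2 := by
  have h : ⟪E.proj s x, x - E.proj s x⟫_ℂ = 0 := by
    rw [inner_starProjection_left (E.isStarProjection s), map_sub,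
      starProjection_apply_apply (E.isStarProjection s), sub_self, inner_zero_right]
  have := norm_add_sq_eq_norm_sq_add_norm_sq_of_inner_eq_zero _ _ h
  rw [add_sub_cancel] at this
  nlinarith

/-- Pythagoras for `E.proj r x` along `E.proj s`, which commutes with `E.proj r`. -/
lemma distribution_eq_add (s : ℝ) (x : H) :
    E.distribution x = E.distribution (E.proj s x) + E.distribution (x - E.proj s x) := by
  ext r
  rw [StieltjesFunction.add_apply, distribution_apply, distribution_apply, distribution_apply,
    E.norm_sq_eq_add s, map_sub, E.proj_comm r s]

lemma measure_distribution_eq_add (s : ℝ) (x : H) :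
    (E.distribution x).measure =
      (E.distribution (E.proj s x)).measure + (E.distribution (x - E.proj s x)).measure := by
  rw [← StieltjesFunction.measure_add, ← distribution_eq_add]

lemma ae_le_of_proj_eq_self {d : ℝ} {x : H} (hx : E.proj d x = x) :
    ∀ᵐ t ∂(E.distribution x).measure, t ≤ d := by
  have h : (E.distribution x).measure (Ioi d) = 0 := by
    rw [(E.distribution x).measure_Ioi (E.tendsto_distribution_atTop x), distribution_apply, hx,
      sub_self, ENNReal.ofReal_zero]
  filter_upwards [measure_eq_zero_iff_ae_notMem.1 h] with t ht
  simpa using ht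

lemma ae_lt_of_proj_eq_zero {c : ℝ} {x : H} (hx : E.proj c x = 0) :
    ∀ᵐ t ∂(E.distribution x).measure, c < t := by
  have h : (E.distribution x).measure (Iic c) = 0 := by
    rw [(E.distribution x).measure_Iic (E.tendsto_distribution_atBot x), distribution_apply, hx]
    simp
  filter_upwards [measure_eq_zero_iff_ae_notMem.1 h] with t ht
  simpa using ht

end SpectralFamily

/-! ### A spectral family of an operator -/

lemma isFormalAdjoint_self {A : H →ₗ.[ℂ] H} (hA : IsSelfAdjoint A) : A.IsFormalAdjoint A := by
  have h : A.adjoint = A := hA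
  have := LinearPMap.adjoint_isFormalAdjoint hA.dense_domain
  rwa [h] at this

namespace SpectralFamily.IsSpectralFamilyOf

variable {E E' : SpectralFamily H} {A : H →ₗ.[ℂ] H}

lemma memLp (h : E.IsSpectralFamilyOf A) {x : H} (hx : x ∈ A.domain) :
    MemLp (fun t : ℝ => t) 2 (E.distribution x).measure := by
  refine (memLp_two_iff_integrable_sq measurable_id.aestronglyMeasurable).2 ⟨by fun_prop, ?_⟩
  change HasFiniteIntegral (fun t : ℝ => t ^ 2) _
  rw [hasFiniteIntegral_iff_ofReal (ae_of_all _ fun t => sq_nonneg t)]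
  exact (h.mem_domain_iff x).1 hx

lemma integrable (h : E.IsSpectralFamilyOf A) {x : H} (hx : x ∈ A.domain) :
    Integrable (fun t : ℝ => t) (E.distribution x).measure :=
  (h.memLp hx).integrable one_le_two

/-- The spectral measure of such a vector is finite and carried by (c, d], so its second moment is
finite. -/
lemma mem_domain_of_ae_bound (h : E.IsSpectralFamilyOf A) {x : H} {c d : ℝ}
    (hc : E.proj c x = 0) (hd : E.proj d x = x) : x ∈ A.domain := by
  rw [h.mem_domain_iff]
  have hle : ∫⁻ t, ENNReal.ofReal (t ^ 2) ∂(E.distribution x).measure ≤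
      ∫⁻ _, ENNReal.ofReal ((|c| + |d|) ^ 2) ∂(E.distribution x).measure := by
    refine lintegral_mono_ae ?_
    filter_upwards [E.ae_le_of_proj_eq_self hd, E.ae_lt_of_proj_eq_zero hc] with t h1 h2
    refine ENNReal.ofReal_le_ofReal (sq_le_sq' ?_ ?_)
    · linarith [neg_abs_le c, abs_nonneg d]
    · linarith [le_abs_self d, abs_nonneg c]
  refine hle.trans_lt ?_
  rw [lintegral_const]
  exact ENNReal.mul_lt_top ENNReal.ofReal_lt_top (measure_lt_top _ _)

/-- The second moment is additive over the two parts of x, with nonnegative terms, so each is finite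
when the sum is. -/
lemma proj_mem_domain (h : E.IsSpectralFamilyOf A) (s : ℝ) {x : H} (hx : x ∈ A.domain) :
    E.proj s x ∈ A.domain := by
  rw [h.mem_domain_iff] at hx ⊢
  rw [E.measure_distribution_eq_add s x, lintegral_add_measure] at hx
  exact (ENNReal.add_lt_top.1 hx).1

lemma re_inner_apply (h : E.IsSpectralFamilyOf A) (x : A.domain) :
    (⟪(x : H), A x⟫_ℂ).re = ∫ t, t ∂(E.distribution (x : H)).measure := by
  rw [h.inner_apply, Complex.ofReal_re]

lemma re_inner_apply_le (h : E.IsSpectralFamilyOf A) (x : A.domain) {d : ℝ}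
    (hd : E.proj d (x : H) = x) : (⟪(x : H), A x⟫_ℂ).re ≤ d * ‖(x : H)‖ ^ 2 := by
  rw [h.re_inner_apply]
  refine (integral_mono_ae (h.integrable x.2) (integrable_const d)
    (E.ae_le_of_proj_eq_self hd)).trans ?_
  rw [integral_const, E.measureReal_distribution_univ, smul_eq_mul, mul_comm]

lemma le_re_inner_apply (h : E.IsSpectralFamilyOf A) (x : A.domain) {c : ℝ}
    (hc : E.proj c (x : H) = 0) : c * ‖(x : H)‖ ^ 2 ≤ (⟪(x : H), A x⟫_ℂ).re := by
  rw [h.re_inner_apply]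
  refine le_trans ?_ (integral_mono_ae (integrable_const c) (h.integrable x.2)
    ((E.ae_lt_of_proj_eq_zero hc).mono fun t ht => ht.le))
  rw [integral_const, E.measureReal_distribution_univ, smul_eq_mul, mul_comm]

/-- The form of `A` is the sum of its restrictions to the range and the kernel of `E s`. -/
lemma re_inner_apply_eq_add (h : E.IsSpectralFamilyOf A) (s : ℝ) (x y z : A.domain)
    (hy : (y : H) = E.proj s x) (hz : (z : H) = x - E.proj s x) :
    (⟪(x : H), A x⟫_ℂ).re = (⟪(y : H), A y⟫_ℂ).re + (⟪(z : H), A z⟫_ℂ).re := by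
  rw [h.re_inner_apply, h.re_inner_apply, h.re_inner_apply,
    E.measure_distribution_eq_add s (x : H), ← hz, ← hy]
  exact integral_add_measure (h.integrable y.2) (h.integrable z.2)

/-- The range and the kernel of `E s` are orthogonal for the form of `A`. -/
lemma re_inner_apply_eq_zero (h : E.IsSpectralFamilyOf A) (hA : IsSelfAdjoint A) (s : ℝ)
    (y z : A.domain) (hy : E.proj s (y : H) = y) (hz : E.proj s (z : H) = 0) :
    (⟪(y : H), A z⟫_ℂ).re = 0 := by
  have h1 : E.proj s ((y + z : A.domain) : H) = y := by
    rw [Submodule.coe_add, map_add, hy, hz, add_zero]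
  have h2 := h.re_inner_apply_eq_add s (y + z) y z h1.symm (by rw [h1]; simp)
  -- Expanding the form at y + z leaves two cross terms; symmetry of A gives them equal real parts,
  -- so their vanishing sum kills each.
  have h3 : (⟪(z : H), A y⟫_ℂ).re = (⟪(y : H), A z⟫_ℂ).re := by
    rw [← isFormalAdjoint_self hA z y, ← inner_conj_symm, Complex.conj_re]
  simp only [LinearPMap.map_add, Submodule.coe_add, inner_add_left, inner_add_right,
    Complex.add_re] at h2
  linarith

/-- `A` commutes with its spectral projections. -/
lemma apply_proj (h : E.IsSpectralFamilyOf A) (hA : IsSelfAdjoint A) (s : ℝ) (x y : A.domain)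
    (hy : (y : H) = E.proj s x) : A y = E.proj s (A x) := by
  have hP := E.isStarProjection s
  have hPy : E.proj s (y : H) = y := by rw [hy, starProjection_apply_apply hP]
  have hPz : ∀ u v : A.domain, (v : H) = E.proj s u → E.proj s ((u - v : A.domain) : H) = 0 := by
    intro u v huv
    rw [Submodule.coe_sub, map_sub, huv, starProjection_apply_apply hP, sub_self]
  -- A maps the kernel of E(s) into itself (`h1`) and the range of E(s) into itself (`h2`). Both are
  -- tested against the dense domain, which E(s) preserves.
  have h1 : E.proj s (A (x - y)) = 0 := by
    refine eq_zero_of_forall_re_inner_eq_zero hA.dense_domain fun u hu => ?_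
    rw [← inner_starProjection_left hP]
    exact h.re_inner_apply_eq_zero hA s ⟨_, h.proj_mem_domain s hu⟩ (x - y)
      (starProjection_apply_apply hP u) (hPz x y hy)
  have h2 : A y - E.proj s (A y) = 0 := by
    refine eq_zero_of_forall_re_inner_eq_zero hA.dense_domain fun u hu => ?_
    have h3 := h.re_inner_apply_eq_zero hA s y
      (⟨u, hu⟩ - ⟨_, h.proj_mem_domain s hu⟩) hPy (hPz _ _ rfl)
    rw [← isFormalAdjoint_self hA, ← inner_conj_symm, Complex.conj_re, Submodule.coe_sub,
      inner_sub_left, inner_starProjection_left hP, ← inner_sub_right] at h3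
    exact h3
  rw [LinearPMap.map_sub, map_sub, sub_eq_zero] at h1
  rw [h1, ← sub_eq_zero, h2]

/-- On the range of `E (c, d]` the operator `A` is at distance at most `(d - c) / 2` from
the scalar `(c + d) / 2`. -/
lemma norm_apply_sub_le (h : E.IsSpectralFamilyOf A) (hA : IsSelfAdjoint A) {c d : ℝ}
    (hcd : c ≤ d) (y : A.domain) (hc : E.proj c (y : H) = 0) (hd : E.proj d (y : H) = y) :
    ‖A y - ((((c + d) / 2 : ℝ)) : ℂ) • (y : H)‖ ≤ (d - c) / 2 * ‖(y : H)‖ := by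
  set k : ℝ := (c + d) / 2 with hk
  set z₀ : H := A y - (k : ℂ) • (y : H) with hz₀
  have hcz : E.proj c z₀ = 0 := by
    rw [hz₀, map_sub, map_smul, hc, ← h.apply_proj hA c y 0 (by rw [hc]; rfl)]
    simp
  have hdz : E.proj d z₀ = z₀ := by
    rw [hz₀, map_sub, map_smul, hd, ← h.apply_proj hA d y y hd.symm]
  -- The vector (A - k)y stays in the range of E(c, d], hence in the domain, so the form bounds
  -- apply to its combinations with y.
  obtain ⟨z, hz⟩ : ∃ z : A.domain, (z : H) = z₀ := ⟨⟨z₀, h.mem_domain_of_ae_bound hcz hdz⟩, rfl⟩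
  have hform : ∀ s t : ℝ, ‖(s : ℂ) • (z : H) + (t : ℂ) • (y : H)‖ ^ 2 =
      s ^ 2 * ‖(z : H)‖ ^ 2 + t ^ 2 * ‖(y : H)‖ ^ 2 + 2 * s * t * (⟪(z : H), (y : H)⟫_ℂ).re := by
    intro s t
    have := norm_add_sq (𝕜 := ℂ) ((s : ℂ) • (z : H)) ((t : ℂ) • (y : H))
    rw [this, norm_smul, norm_smul, Complex.norm_real, Complex.norm_real, mul_pow, mul_pow,
      Real.norm_eq_abs, Real.norm_eq_abs, sq_abs, sq_abs, inner_smul_left, inner_smul_right,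
      Complex.conj_ofReal]
    change _ + 2 * ((s : ℂ) * ((t : ℂ) * ⟪(z : H), (y : H)⟫_ℂ)).re + _ = _
    rw [Complex.re_ofReal_mul, Complex.re_ofReal_mul]
    ring
  have hsymm : (⟪(y : H), A z⟫_ℂ).re = (⟪(z : H), A y⟫_ℂ).re := by
    rw [← isFormalAdjoint_self hA y z, ← inner_conj_symm, Complex.conj_re]
  have hq : ∀ s t : ℝ, (⟪((((s : ℂ) • z + (t : ℂ) • y : A.domain)) : H),
      A ((s : ℂ) • z + (t : ℂ) • y)⟫_ℂ).re =
      s ^ 2 * (⟪(z : H), A z⟫_ℂ).re + t ^ 2 * (⟪(y : H), A y⟫_ℂ).re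
        + 2 * s * t * (⟪(z : H), A y⟫_ℂ).re := by
    intro s t
    simp only [LinearPMap.map_add, LinearPMap.map_smul, Submodule.coe_add, Submodule.coe_smul,
      inner_add_left, inner_add_right, inner_smul_left, inner_smul_right, Complex.add_re,
      Complex.conj_ofReal, Complex.re_ofReal_mul, hsymm]
    ring
  have hproj : ∀ (s t r : ℝ), E.proj r ((((s : ℂ) • z + (t : ℂ) • y : A.domain)) : H) =
      (s : ℂ) • E.proj r z₀ + (t : ℂ) • E.proj r (y : H) := by
    intro s t r
    rw [Submodule.coe_add, Submodule.coe_smul, Submodule.coe_smul, map_add, map_smul, map_smul, hz]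
  have hcoe : ∀ s t : ℝ, ((((s : ℂ) • z + (t : ℂ) • y : A.domain)) : H) =
      (s : ℂ) • (z : H) + (t : ℂ) • (y : H) := fun s t => rfl
  have hup : ∀ s t : ℝ, _ := fun s t =>
    h.re_inner_apply_le ((s : ℂ) • z + (t : ℂ) • y) (d := d) (by rw [hproj, hdz, hd, hcoe, hz])
  have hlow : ∀ s t : ℝ, _ := fun s t =>
    h.le_re_inner_apply ((s : ℂ) • z + (t : ℂ) • y) (c := c) (by rw [hproj, hcz, hc]; simp)
  have hzz : (⟪(z : H), A y⟫_ℂ).re = ‖(z : H)‖ ^ 2 + k * (⟪(z : H), (y : H)⟫_ℂ).re := by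
    have e : A y = (z : H) + (k : ℂ) • (y : H) := by rw [hz, hz₀]; abel
    have e2 : (⟪(z : H), (z : H)⟫_ℂ).re = ‖(z : H)‖ ^ 2 := inner_self_eq_norm_sq (𝕜 := ℂ) _
    rw [e, inner_add_right, Complex.add_re, inner_smul_right, Complex.re_ofReal_mul, e2]
  rw [← hz]
  set a := ‖(z : H)‖
  set b := ‖(y : H)‖
  have ha : 0 ≤ a := norm_nonneg _
  have hb : 0 ≤ b := norm_nonneg _
  -- Polarization: the upper bound d at ‖y‖z + ‖z‖y minus the lower bound c at ‖y‖z - ‖z‖y. The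
  -- weights make both summands equally long, and the choice of k as midpoint cancels the terms in
  -- Re⟪z, y⟫.
  have h1 := hup b a
  have h2 := hlow b (-a)
  rw [hq, hcoe, hform, hzz] at h1 h2
  have h3 : a ^ 3 * b ≤ (d - c) / 2 * (a ^ 2 * b ^ 2) := by
    rw [hk] at h1 h2
    linarith
  -- The estimate is to be divided by a² b, so the cases a = 0 and b = 0 are treated apart.
  rcases ha.eq_or_lt with ha | ha
  · rw [← ha]
    exact mul_nonneg (by linarith) hb
  rcases hb.eq_or_lt with hb | hb
  · have hy0 : y = 0 := Subtype.ext (norm_eq_zero.1 hb.symm)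
    have : (z : H) = 0 := by rw [hz, hz₀, hy0]; simp
    simp [a, this] at ha
  · have : a ^ 2 * b * a ≤ a ^ 2 * b * ((d - c) / 2 * b) := by linarith
    exact le_of_mul_le_mul_left this (by positivity)

/-- On the range of `E b` the operator `A` is at distance at least `k - b` from `k ≥ b`. -/
lemma le_norm_apply_sub (h : E.IsSpectralFamilyOf A) {b k : ℝ}
    (x : A.domain) (hb : E.proj b (x : H) = x) :
    (k - b) * ‖(x : H)‖ ≤ ‖A x - (k : ℂ) • (x : H)‖ := by
  have h1 := h.re_inner_apply_le x hb
  have h2 : (⟪(x : H), (k : ℂ) • (x : H) - A x⟫_ℂ).re =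
      k * ‖(x : H)‖ ^ 2 - (⟪(x : H), A x⟫_ℂ).re := by
    have e2 : (⟪(x : H), (x : H)⟫_ℂ).re = ‖(x : H)‖ ^ 2 := inner_self_eq_norm_sq (𝕜 := ℂ) _
    rw [inner_sub_right, inner_smul_right, Complex.sub_re, Complex.re_ofReal_mul, e2]
  have h3 : (⟪(x : H), (k : ℂ) • (x : H) - A x⟫_ℂ).re ≤
      ‖(x : H)‖ * ‖A x - (k : ℂ) • (x : H)‖ := by
    rw [norm_sub_rev]
    exact re_inner_le_norm (𝕜 := ℂ) _ _
  rcases (norm_nonneg (x : H)).eq_or_lt with h0 | h0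
  · rw [← h0, mul_zero]
    exact norm_nonneg _
  · refine le_of_mul_le_mul_left ?_ h0
    linarith

/-- Spectral subspaces of `A` for separated sets are orthogonal, also when they come from
different spectral families. -/
lemma proj_comp_sub_eq_zero (h : E.IsSpectralFamilyOf A) (h' : E'.IsSpectralFamilyOf A)
    (hA : IsSelfAdjoint A) {b c d : ℝ} (hbc : b < c) (hcd : c ≤ d) :
    E.proj b * (E'.proj d - E'.proj c) = 0 := by
  set F := E'.proj d - E'.proj c with hF
  set X := E.proj b * F with hX
  have hFc : ∀ v, E'.proj c (F v) = 0 := fun v => by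
    rw [hF, sub_apply, map_sub, E'.proj_proj_of_ge hcd,
      starProjection_apply_apply (E'.isStarProjection c), sub_self]
  have hFd : ∀ v, E'.proj d (F v) = F v := fun v => by
    rw [hF, sub_apply, map_sub, E'.proj_proj_of_le hcd,
      starProjection_apply_apply (E'.isStarProjection d)]
  -- F v is the component of `E'.proj d v` orthogonal to the range of `E'.proj c`.
  have hFle : ∀ v, ‖F v‖ ≤ ‖v‖ := fun v => by
    have h1 := E'.norm_sq_eq_add c (E'.proj d v)
    rw [E'.proj_proj_of_ge hcd] at h1
    refine (abs_le_of_sq_le_sq' ?_ (norm_nonneg (E'.proj d v))).2.trans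
      (norm_proj_le _ (E'.isStarProjection d) v)
    rw [h1, hF, sub_apply]
    nlinarith [sq_nonneg ‖E'.proj c v‖]
  set k : ℝ := (c + d) / 2 with hk
  have key : ∀ v, (k - b) * ‖X v‖ ≤ (d - c) / 2 * ‖X‖ * ‖v‖ := by
    intro v
    let y : A.domain := ⟨F v, h'.mem_domain_of_ae_bound (hFc v) (hFd v)⟩
    let x : A.domain := ⟨E.proj b (F v), h.proj_mem_domain b y.2⟩
    have e1 : A x = E.proj b (A y) := h.apply_proj hA b y x rfl
    have e2 : F (A y - (k : ℂ) • (y : H)) = A y - (k : ℂ) • (y : H) := by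
      have ed : E'.proj d (A y) = A y := (h'.apply_proj hA d y y (hFd v).symm).symm
      have ec : E'.proj c (A y) = 0 := by
        rw [← h'.apply_proj hA c y 0 (hFc v).symm, LinearPMap.map_zero]
      rw [hF, sub_apply, map_sub, map_sub, map_smul, map_smul, ed, ec, hFc v, hFd v]
      simp [y, hF]
    -- F fixes (A - k)y, so X itself reappears; this puts ‖X‖ on the right-hand side of `key` and
    -- makes the estimate self-improving.
    have e3 : A x - (k : ℂ) • (x : H) = X (A y - (k : ℂ) • (y : H)) := by
      change _ = E.proj b (F _)
      rw [e2, map_sub, map_smul, e1]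
    calc (k - b) * ‖X v‖ ≤ ‖A x - (k : ℂ) • (x : H)‖ :=
          h.le_norm_apply_sub x (starProjection_apply_apply (E.isStarProjection b) _)
      _ ≤ ‖X‖ * ‖A y - (k : ℂ) • (y : H)‖ := by rw [e3]; exact X.le_opNorm _
      _ ≤ ‖X‖ * ((d - c) / 2 * ‖(y : H)‖) := by
          gcongr
          exact h'.norm_apply_sub_le hA hcd y (hFc v) (hFd v)
      _ ≤ ‖X‖ * ((d - c) / 2 * ‖v‖) := by
          gcongr
          exact hFle v
      _ = _ := by ring
  have hkb : 0 < k - b := by rw [hk]; linarith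
  have hle : ‖X‖ ≤ (d - c) / 2 * ‖X‖ / (k - b) := by
    refine X.opNorm_le_bound (by have := norm_nonneg X; positivity) fun v => ?_
    rw [div_mul_eq_mul_div, le_div_iff₀ hkb, mul_comm]
    exact key v
  rw [le_div_iff₀ hkb] at hle
  refine norm_le_zero_iff.1 ?_
  rw [hk] at hle
  -- Since k - (d - c)/2 = c, the inequality reads (c - b)‖X‖ ≤ 0.
  nlinarith

/-- The orthogonality needs a gap b < c. Letting d → ∞ gives E(b)E'(c) = E(b) for every c > b, and
right-continuity of E' closes the gap as c ↓ b. -/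
lemma proj_proj_eq (h : E.IsSpectralFamilyOf A) (h' : E'.IsSpectralFamilyOf A)
    (hA : IsSelfAdjoint A) (b : ℝ) (v : H) : E.proj b (E'.proj b v) = E.proj b v := by
  have h1 : ∀ c, b < c → E.proj b (E'.proj c v) = E.proj b v := by
    intro c hbc
    have hlim : Tendsto (fun d => E.proj b (E'.proj d v)) atTop (𝓝 (E.proj b v)) :=
      ((E.proj b).continuous.tendsto v).comp (E'.tendsto_atTop v)
    refine tendsto_nhds_unique (tendsto_const_nhds.congr' ?_) hlim
    filter_upwards [eventually_ge_atTop c] with d hcd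
    have := congrArg (fun T : H →L[ℂ] H => T v) (h.proj_comp_sub_eq_zero h' hA hbc hcd)
    change E.proj b (E'.proj d v - E'.proj c v) = 0 at this
    rw [map_sub, sub_eq_zero] at this
    exact this.symm
  have hlim : Tendsto (fun c => E.proj b (E'.proj c v)) (𝓝[>] b) (𝓝 (E.proj b (E'.proj b v))) :=
    ((E.proj b).continuous.tendsto _).comp
      ((E'.right_continuous v b).mono_left (nhdsWithin_mono _ Ioi_subset_Ici_self))
  refine tendsto_nhds_unique hlim (tendsto_const_nhds.congr' ?_)
  filter_upwards [self_mem_nhdsWithin] with c hc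
  exact (h1 c hc).symm

/-- The spectral family of a self-adjoint operator is unique. -/
theorem unique (h : E.IsSpectralFamilyOf A) (h' : E'.IsSpectralFamilyOf A)
    (hA : IsSelfAdjoint A) : E = E' := by
  ext r v
  refine ext_inner_left ℂ fun w => ?_
  rw [← inner_starProjection_left (E.isStarProjection r), ← h.proj_proj_eq h' hA r w,
    inner_starProjection_left (E.isStarProjection r),
    inner_starProjection_left (E'.isStarProjection r), h'.proj_proj_eq h hA r v]

end SpectralFamily.IsSpectralFamilyOf
end SpectralUniqueness

/-! ### Conjugation by a unitary operator -/

section Conjugation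

variable {H : Type*} [NormedAddCommGroup H] [InnerProductSpace ℂ H] [CompleteSpace H]

/-- The spectral family `U⁻¹ E U`. -/
noncomputable def SpectralFamily.conj (E : SpectralFamily H) (U : H ≃ₗᵢ[ℂ] H) :
    SpectralFamily H where
  proj r := (U.symm.toContinuousLinearEquiv : H →L[ℂ] H) ∘L E.proj r ∘L
    (U.toContinuousLinearEquiv : H →L[ℂ] H)
  isStarProjection r :=
    { isIdempotentElem := by
        ext x
        change U.symm (E.proj r (U (U.symm (E.proj r (U x))))) = U.symm (E.proj r (U x))
        rw [U.apply_symm_apply, starProjection_apply_apply (E.isStarProjection r)]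
      isSelfAdjoint := by
        rw [ContinuousLinearMap.isSelfAdjoint_iff_isSymmetric]
        intro x y
        change ⟪U.symm (E.proj r (U x)), y⟫_ℂ = ⟪x, U.symm (E.proj r (U y))⟫_ℂ
        rw [← U.inner_map_map, U.apply_symm_apply,
          inner_starProjection_left (E.isStarProjection r), ← U.inner_map_map x,
          U.apply_symm_apply] }
  mul_of_le r s hrs := by
    ext x
    change U.symm (E.proj s (U (U.symm (E.proj r (U x))))) = U.symm (E.proj r (U x))
    rw [U.apply_symm_apply, E.proj_proj_of_le hrs]
  right_continuous x r :=
    U.symm.continuous.continuousAt.comp_continuousWithinAt (E.right_continuous (U x) r)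
  tendsto_atBot x := by
    have := (U.symm.continuous.tendsto 0).comp (E.tendsto_atBot (U x))
    rwa [map_zero] at this
  tendsto_atTop x := by
    have := (U.symm.continuous.tendsto (U x)).comp (E.tendsto_atTop (U x))
    rwa [U.symm_apply_apply] at this

lemma SpectralFamily.conj_proj_apply (E : SpectralFamily H) (U : H ≃ₗᵢ[ℂ] H) (r : ℝ) (x : H) :
    (E.conj U).proj r x = U.symm (E.proj r (U x)) := rfl

lemma SpectralFamily.distribution_conj (E : SpectralFamily H) (U : H ≃ₗᵢ[ℂ] H) (x : H) :
    (E.conj U).distribution x = E.distribution (U x) := by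
  ext r
  rw [distribution_apply, distribution_apply, conj_proj_apply, U.symm.norm_map]

lemma SpectralFamily.IsSpectralFamilyOf.conj {E : SpectralFamily H} {A : H →ₗ.[ℂ] H}
    (h : E.IsSpectralFamilyOf A) (U : H ≃ₗᵢ[ℂ] H) :
    (E.conj U).IsSpectralFamilyOf (conjPMap A U) where
  mem_domain_iff x := by
    rw [E.distribution_conj]
    exact h.mem_domain_iff (U x)
  inner_apply x := by
    rw [E.distribution_conj]
    refine Eq.trans ?_ (h.inner_apply ⟨U x, x.2⟩)
    change ⟪(x : H), U.symm (A ⟨U x, x.2⟩)⟫_ℂ = _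
    rw [← U.inner_map_map, U.apply_symm_apply]

/-- Used to carry a spectral family of U⁻¹AU back to one of A. -/
lemma conjPMap_conjPMap_symm (A : H →ₗ.[ℂ] H) (U : H ≃ₗᵢ[ℂ] H) :
    conjPMap (conjPMap A U) U.symm = A := by
  refine LinearPMap.ext ?_ ?_
  · ext x
    change U (U.symm x) ∈ A.domain ↔ _
    rw [U.apply_symm_apply]
  · intro x hx hx'
    change U (U.symm (A ⟨U (U.symm x), hx⟩)) = A ⟨x, hx'⟩
    rw [U.apply_symm_apply]
    exact congrArg A (Subtype.ext (U.apply_symm_apply x))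

/-! ### Spectral projections and distribution functions under conjugation -/

namespace SelfAdjointOperator

lemma spectralProj_eq (A : SelfAdjointOperator H) {E : SpectralFamily H}
    (h : E.IsSpectralFamilyOf A.1) (r : ℝ) : A.spectralProj r = E.proj r := by
  have hex : ∃ E : SpectralFamily H, E.IsSpectralFamilyOf A.1 := ⟨E, h⟩
  rw [spectralProj, dif_pos hex, hex.choose_spec.unique h A.2]

/-- The spectral projections of `U⁻¹ A U` are the conjugates of those of `A`. -/
lemma spectralProj_conj (A : SelfAdjointOperator H) (U : H ≃ₗᵢ[ℂ] H) (r : ℝ) (x : H) :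
    (A.conj U).spectralProj r x = U.symm (A.spectralProj r (U x)) := by
  by_cases h : ∃ E : SpectralFamily H, E.IsSpectralFamilyOf A.1
  · obtain ⟨E, hE⟩ := h
    rw [A.spectralProj_eq hE, (A.conj U).spectralProj_eq (hE.conj U), E.conj_proj_apply]
  -- Existence passes between A and U⁻¹AU in both directions, so in this case both projections take
  -- the default value 0 and the spectral theorem is not needed.
  · have h' : ¬ ∃ E : SpectralFamily H, E.IsSpectralFamilyOf (A.conj U).1 := by
      rintro ⟨E, hE⟩
      have := hE.conj U.symm
      rw [show (A.conj U).1 = conjPMap A.1 U from rfl, conjPMap_conjPMap_symm] at this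
      exact h ⟨_, this⟩
    rw [spectralProj, dif_neg h', spectralProj, dif_neg h]
    simp

end SelfAdjointOperator

lemma distributionFunction_conj (A : SelfAdjointOperator H) (U : H ≃ₗᵢ[ℂ] H) (p : ℙ ℂ H) :
    distributionFunction (A.conj U) p = distributionFunction A (projAction U p) := by
  funext r
  induction p using Projectivization.ind with
  | h v hv =>
    change (⟪v, (A.conj U).spectralProj r v⟫_ℂ).re / ‖v‖ ^ 2 =
      (⟪U v, A.spectralProj r (U v)⟫_ℂ).re / ‖U v‖ ^ 2
    rw [A.spectralProj_conj, ← U.inner_map_map, U.apply_symm_apply, U.norm_map]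

end Conjugation

/-! ### The automorphism of complete states -/

section Automorphism

variable {Z : Type*} [MeasurableSpace Z] {ν ν' : Measure Z}

lemma BorelEquivalence.trans_mem_transDomain (σ : BorelEquivalence ν) (σ' : BorelEquivalence ν')
    (z : transDomain σ σ') : BorelEquivalence.trans σ σ' z ∈ transDomain σ' σ := by
  refine ⟨Subtype.coe_prop _, ?_⟩
  simp [BorelEquivalence.trans]

lemma BorelEquivalence.trans_trans (σ : BorelEquivalence ν) (σ' : BorelEquivalence ν')
    (z : transDomain σ σ') :
    BorelEquivalence.trans σ' σ ⟨_, trans_mem_transDomain σ σ' z⟩ = z := by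
  simp [BorelEquivalence.trans]

/-- The image of z always falls in the branch where the composition is defined, so the equality is
pointwise, with no exceptional null set. -/
lemma Barrier.transport_trans (α : Barrier ν) (σ : BorelEquivalence ν) (σ' : BorelEquivalence ν')
    (z : BorelEquivalence.transDomain σ σ') :
    (α.transport σ σ').toFun (BorelEquivalence.trans σ σ' z) = α.toFun z := by
  refine (dif_pos (BorelEquivalence.trans_mem_transDomain σ σ' z)).trans ?_
  rw [BorelEquivalence.trans_trans]

end Automorphism
end CompleteQM

theorem mainTheorem8
    {H : Type*} [NormedAddCommGroup H] [InnerProductSpace ℂ H] [CompleteSpace H]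
    [TopologicalSpace.SeparableSpace H] (hH : ¬ FiniteDimensional ℂ H)
    {Z : Type*} [MeasurableSpace Z] [StandardBorelSpace Z] [Uncountable Z]
    (μ : ℙ ℂ H → Measure Z) (hprob : ∀ p, IsProbabilityMeasure (μ p))
    (hatoms : ∀ p, NullSingletonClass (μ p))
    (A : CompleteQM.SelfAdjointOperator H) (σ : CompleteQM.ComplexOfEquivalences μ)
    (U : H ≃ₗᵢ[ℂ] H) :
    (∀ c : CompleteQM.automorphismDomain U σ,
      CompleteQM.valuesFunction (A.conj U) (c : CompleteQM.CompleteState μ) =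
        (CompleteQM.valuesFunction A ∘ CompleteQM.automorphism U σ) c) ∧
    (∀ (p : ℙ ℂ H) (α : CompleteQM.Barrier (μ p)),
      ∀ᵐ z ∂(μ p), CompleteQM.CompleteState.mk p α z ∈ CompleteQM.automorphismDomain U σ) ∧
    ((∀ p, (σ p).source = Set.univ ∧ (σ p).target = Set.univ) →
      CompleteQM.automorphismDomain U σ = Set.univ) := by
  refine ⟨fun c => ?_, fun p α => ?_, fun hσ => ?_⟩
  -- The two quantiles differ only in the level and in the distribution function; one rewrite
  -- matches each.
  · change CompleteQM.quasiInverse (CompleteQM.distributionFunction (A.conj U) c.1.state)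
        (c.1.barrier.toFun c.1.label : ℝ) =
      CompleteQM.quasiInverse
        (CompleteQM.distributionFunction A (CompleteQM.projAction U c.1.state))
        ((c.1.barrier.transport (σ c.1.state) (σ (CompleteQM.projAction U c.1.state))).toFun
          (CompleteQM.BorelEquivalence.trans (σ c.1.state)
            (σ (CompleteQM.projAction U c.1.state)) ⟨c.1.label, c.2⟩) : ℝ)
    rw [CompleteQM.Barrier.transport_trans, CompleteQM.distributionFunction_conj]
  · exact mem_ae_iff.2 (CompleteQM.BorelEquivalence.transDomain_compl_null (σ p) (σ (CompleteQM.projAction U p)))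
  · refine Set.eq_univ_of_forall fun c => ⟨?_, ?_⟩
    · rw [(hσ _).1]
      trivial
    · rw [(hσ _).2]
      trivial
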